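/- Let $X$ be a closed hyperbolic surface, i.e. a compact connected oriented surface without boundary with a Riemannian metric of constant curvature $-1$; equivalently $X=\Gamma\backslash\mathbb{H}$ is a compact quotient of the hyperbolic plane by a group $\Gamma$ of orientation-preserving isometries that acts freely and properly discontinuously. For $q\in X$ let the injectivity radius $\mathrm{inj}_X(q)$ be half of the length of a shortest (homotopically) nontrivial geodesic loop based at $q$, where a geodesic loop need not be smooth at its base point. Let $p\in X$ satisfy $\mathrm{inj}_X(p)\le \operatorname{arcsinh}(1)$, and let $\sigma:[0,2\,\mathrm{inj}_X(p)]\to X$ be a shortest nontrivial geodesic loop based at $p$, parametrized by arc length. Then for every $s\in[0,2\,\mathrm{inj}_X(p)]$, $$(\sqrt2-1)\,\mathrm{inj}_X(p)\;\le\;\mathrm{inj}_X(\sigma(s))\;\le\;\mathrm{inj}_X(p).$$ -/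

import Mathlib

open scoped UpperHalfPlane MatrixGroups

/-- A metric space `X` is a closed hyperbolic surface if it is compact and is the quotient `Γ \ ℍ`
of the hyperbolic plane, with its quotient (Riemannian) distance, by a group `Γ` of orientation
preserving isometries acting freely and properly discontinuously. The group is given by a subgroup
of `SL(2, ℝ)`, so freeness says that an element with a fixed point in `ℍ` acts as the identity
(it is `1` or `-1`). The map `π` is the quotient map. -/
def IsClosedHyperbolicSurface (X : Type*) [MetricSpace X] : Prop :=
  CompactSpace X ∧
    ∃ (Γ : Subgroup SL(2, ℝ)) (π : ℍ → X),
      ProperlyDiscontinuousSMul Γ ℍ ∧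
      (∀ (γ : Γ) (z : ℍ), γ • z = z → ∀ w : ℍ, γ • w = w) ∧
      Function.Surjective π ∧
      (∀ z w : ℍ, π z = π w ↔ ∃ γ : Γ, γ • z = w) ∧
      ∀ z w : ℍ, dist (π z) (π w) = ⨅ γ : Γ, dist z (γ • w)

/-- The restriction of `σ` to `[0, L]` is a homotopically nontrivial geodesic loop based at `p`,
of length `L` and parametrized by arc length. It is a geodesic in that it preserves distances
locally on `[0, L]`; no smoothness is required at the base point, where the loop may have a
corner. -/
structure IsNontrivialGeodesicLoop {X : Type*} [MetricSpace X] (p : X) (L : ℝ) (σ : ℝ → X) :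
    Prop where
  length_pos : 0 < L
  source : σ 0 = p
  target : σ L = p
  geodesic : ∀ s ∈ Set.Icc 0 L, ∃ ε > 0, ∀ t ∈ Set.Icc 0 L, ∀ u ∈ Set.Icc 0 L,
    |t - s| < ε → |u - s| < ε → dist (σ t) (σ u) = |t - u|
  nontrivial : ∃ γ : Path p p, (∀ t : unitInterval, γ t = σ (L * (t : ℝ))) ∧
    ¬ γ.Homotopic (Path.refl p)

/-- `σ` on `[0, L]` is a shortest nontrivial geodesic loop based at `p`. -/
def IsShortestGeodesicLoop {X : Type*} [MetricSpace X] (p : X) (L : ℝ) (σ : ℝ → X) : Prop :=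
  IsNontrivialGeodesicLoop p L σ ∧
    ∀ (L' : ℝ) (τ : ℝ → X), IsNontrivialGeodesicLoop p L' τ → L ≤ L'

/-- The injectivity radius at `p`: half of the least length of a nontrivial geodesic loop
based at `p`. -/
noncomputable def injRadius {X : Type*} [MetricSpace X] (p : X) : ℝ :=
  sInf {L : ℝ | ∃ σ : ℝ → X, IsNontrivialGeodesicLoop p L σ} / 2

/-!
Write `X = Γ \ ℍ` with quotient map `π`. Since `Γ` acts freely and properly discontinuously, `π` is
a covering map and a local isometry, and `ℍ` is simply connected. A nontrivial geodesic loop of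
length `L` at `π z` therefore lifts to a path of length `L` from `z` to `γ z ≠ z`
(`IsFuchsianQuotientMap.exists_lift`), and conversely the geodesic segment from `z` to `γ z ≠ z`
projects to a nontrivial geodesic loop (`IsFuchsianQuotientMap.isNontrivialGeodesicLoop`). So
`2 * injRadius (π z)` is the infimum of the displacements `d(z, γ z)` over the nontrivial `γ`.

Let the shortest loop at `π z`, of length `L`, lift to a path from `z` to `γ z`. The lift is a
segment of length `d(z, γ z) = L`, and for a point `w` on it, at distance `s` from `z`,
`d(w, γ w) ≤ d(w, γ z) + d(γ z, γ w) ≤ (L - s) + s = L`. This is the upper bound.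

For the lower bound let `η ∈ Γ` be nontrivial with `d(w, η w) < (√2 - 1) L ≤ 2 (√2 - 1) arsinh 1`.
* Then `γ` and `η` commute (`commute_of_dist_smul_lt`). Every element of `Γ` other than `±1` is
  hyperbolic, freeness excluding elliptic elements and compactness of `X` parabolic ones. Conjugate
  `w` to `I`, and apply this to products of `η` and `η' = γ η γ⁻¹`. With `U` half the trace of the
  product of the traceless parts of `η` and `η'`, and `1 + N = (tr η / 2) ^ 2`, the half-traces of
  `η η'` and `η η'⁻¹` are `1 + N ± U`, and the commutator of `η` and `η'` has half-trace
  `1 - 2 (N ^ 2 - U ^ 2)`. The displacement bounds give `N < 1` and `|U| < 2`, so that these three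
  elements cannot all be hyperbolic. It follows that `η η'` or `η η'⁻¹` is `±1`, and then `γ` and
  `η` commute.
* The traceless parts of commuting elements are proportional, so `sinh (d(v, η v) / 2)` is a
  constant multiple of `sinh (d(v, γ v) / 2)`. The comparison `d(z, γ z) ≤ d(z, η z)` at `z` thus
  persists at `w` (`dist_smul_le_dist_smul_of_commute`), and it suffices to bound `d(w, γ w)` from
  below.
* The path from `z` to `γ² z` through `w` and `γ w` gives `d(z, γ² z) ≤ L + d(w, γ w)`, while
  `sinh (d(z, γ² z) / 2) = |tr γ| sinh (L / 2) ≥ 2 sinh (L / 2) ≥ sinh (√2 L / 2)` because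
  `L / 2 ≤ arsinh 1` (`sinh_half_dist_smul_smul`, `sinh_sqrt_two_mul_le`). Hence
  `d(w, γ w) ≥ (√2 - 1) L`.
-/

/-! ### Displacement functions of elements of `SL(2, ℝ)` -/

/-- The displacement of `z` under `A = !![a, b; c, d]`, in terms of the quadratic polynomial
`c z ^ 2 + (d - a) z - b` whose roots are the fixed points of `A`. It depends only on the traceless
part of `A`. -/
theorem sinh_half_dist_smul (A : SL(2, ℝ)) (z : ℍ) :
    Real.sinh (dist z (A • z) / 2) =
      ‖(A 1 0 * (z : ℂ) ^ 2 + (A 1 1 - A 0 0) * z - A 0 1 : ℂ)‖ / (2 * z.im) := by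
  have hd := A.det_coe
  rw [Matrix.det_fin_two] at hd
  have hden : (A 1 0 * z + A 1 1 : ℂ) ≠ 0 := by
    have := UpperHalfPlane.denom_ne_zero (A : GL (Fin 2) ℝ) z
    simpa [UpperHalfPlane.denom] using this
  have hcoe : ((A • z : ℍ) : ℂ) = (A 0 0 * z + A 0 1) / (A 1 0 * z + A 1 1) := by
    rw [UpperHalfPlane.coe_specialLinearGroup_apply]; simp
  have him : (A • z).im = z.im / ‖(A 1 0 * z + A 1 1 : ℂ)‖ ^ 2 := by
    rw [← UpperHalfPlane.coe_im, hcoe, Complex.div_im, ← Complex.normSq_eq_norm_sq]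
    rw [← sub_div]
    congr 1
    simp
    linear_combination z.im * hd
  have hn : 0 < ‖(A 1 0 * z + A 1 1 : ℂ)‖ := by simpa using hden
  have hsub : (z : ℂ) - (A 0 0 * z + A 0 1) / (A 1 0 * z + A 1 1) =
      (A 1 0 * (z : ℂ) ^ 2 + (A 1 1 - A 0 0) * z - A 0 1) / (A 1 0 * z + A 1 1) := by
    rw [eq_div_iff hden, sub_mul, div_mul_cancel₀ _ hden]
    ring
  rw [UpperHalfPlane.sinh_half_dist, hcoe, him, dist_eq_norm, hsub, norm_div,
    ← mul_div_assoc, ← sq, ← div_pow, Real.sqrt_sq (div_nonneg z.im_pos.le hn.le)]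
  have := z.im_pos
  field_simp

theorem sq_sinh_half_dist_I_smul (A : SL(2, ℝ)) :
    4 * Real.sinh (dist UpperHalfPlane.I (A • UpperHalfPlane.I) / 2) ^ 2 =
      (A 0 0 - A 1 1) ^ 2 + (A 0 1 + A 1 0) ^ 2 := by
  rw [sinh_half_dist_smul, div_pow, ← Complex.normSq_eq_norm_sq]
  simp [Complex.normSq_apply, UpperHalfPlane.I_im]
  ring

/-! ### Elements of small displacement commute -/

/-- A matrix of determinant `1` with squared Frobenius norm at most `6` has squared operator norm at
most `3 + 2 * √2`, the larger root of `l ^ 2 - 6 * l + 1`. -/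
theorem sq_add_sq_le_of_norm_le {a b c d : ℝ} (hdet : a * d - b * c = 1)
    (h : a ^ 2 + b ^ 2 + c ^ 2 + d ^ 2 ≤ 6) (x y : ℝ) :
    (a * x + b * y) ^ 2 + (c * x + d * y) ^ 2 ≤ (3 + 2 * √2) * (x ^ 2 + y ^ 2) := by
  set l : ℝ := 3 + 2 * √2 with hl
  have h2 : √2 ^ 2 = 2 := Real.sq_sqrt (by norm_num)
  have hl2 : l ^ 2 = 6 * l - 1 := by rw [hl]; linear_combination 4 * h2
  have hl3 : 3 ≤ l := by rw [hl]; have := Real.sqrt_nonneg 2; linarith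
  set P := l - (a ^ 2 + c ^ 2) with hP
  set R := l - (b ^ 2 + d ^ 2) with hR
  set M := a * b + c * d with hM
  -- `!![P, -M; -M, R]` is `l - AᵀA`; its determinant and its trace are nonnegative
  have hPR : P * R - M ^ 2 = l * (6 - (a ^ 2 + b ^ 2 + c ^ 2 + d ^ 2)) := by
    rw [hP, hR, hM]
    linear_combination hl2 + (a * d - b * c + 1) * hdet
  have hPR' : M ^ 2 ≤ P * R := by
    have : 0 ≤ l * (6 - (a ^ 2 + b ^ 2 + c ^ 2 + d ^ 2)) := mul_nonneg (by linarith) (by linarith)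
    linarith
  have hsum : 0 ≤ P + R := by rw [hP, hR]; linarith
  have hP0 : 0 ≤ P := by nlinarith [sq_nonneg M]
  have hR0 : 0 ≤ R := by nlinarith [sq_nonneg M]
  have key : 2 * (M * x * y) ≤ P * x ^ 2 + R * y ^ 2 := by
    apply le_of_abs_le
    apply abs_le_of_sq_le_sq _ (by positivity)
    have : (M * x * y) ^ 2 ≤ (P * x ^ 2) * (R * y ^ 2) := by
      have := mul_le_mul_of_nonneg_right hPR' (sq_nonneg (x * y))
      linarith
    nlinarith [sq_nonneg (P * x ^ 2 - R * y ^ 2)]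
  rw [hP, hR, hM] at key
  linarith

/-- The pairing of a traceless matrix `!![e, f; g, -e]` with its conjugate by `A = !![a, b; c, d]`
is at most the product of their Frobenius norms, and conjugation by `A` stretches norms by at most
`‖A‖ ^ 2 ≤ 3 + 2 * √2`. -/
theorem abs_trace_mul_conj_lt {a b c d e f g : ℝ} (hdet : a * d - b * c = 1)
    (h : a ^ 2 + b ^ 2 + c ^ 2 + d ^ 2 ≤ 6)
    (hk : e ^ 2 + ((f + g) / 2) ^ 2 < 3 - 2 * √2) (hN : 0 ≤ e ^ 2 + f * g) :
    |Matrix.trace (!![e, f; g, -e] * (!![a, b; c, d] * !![e, f; g, -e] * !![d, -b; -c, a]))| <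
      4 := by
  have h2 : √2 ^ 2 = 2 := Real.sq_sqrt (by norm_num)
  have hF : 2 * e ^ 2 + f ^ 2 + g ^ 2 < 4 * (3 - 2 * √2) := by nlinarith
  have hl : 0 < 3 + 2 * √2 := by positivity
  have h1 := sq_add_sq_le_of_norm_le hdet h (-f) e
  have h1' := sq_add_sq_le_of_norm_le hdet h e g
  have ht : a * d - c * b = 1 := by linarith
  have h3 := sq_add_sq_le_of_norm_le ht (by linarith) (-g) e
  have h3' := sq_add_sq_le_of_norm_le ht (by linarith) e f
  have hlF : (3 + 2 * √2) * (2 * e ^ 2 + f ^ 2 + g ^ 2) < 4 := by nlinarith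
  have pair (x y : ℝ) : |x * y| ≤ (x ^ 2 + y ^ 2) / 2 := by
    rw [abs_le]
    constructor <;> nlinarith [sq_nonneg (x + y), sq_nonneg (x - y)]
  have p1 := abs_le.mp (pair (a * (-g) + c * e) (a * (-f) + b * e))
  have p2 := abs_le.mp (pair (b * (-g) + d * e) (a * e + b * g))
  have p3 := abs_le.mp (pair (a * e + c * f) (c * (-f) + d * e))
  have p4 := abs_le.mp (pair (b * e + d * f) (c * e + d * g))
  -- `A⁻¹ = J Aᵀ J⁻¹` turns the trace into the entrywise pairing of `S A` and `A S'`, where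
  -- `S = !![-g, e; e, f]` and `S' = !![-f, e; e, g]`
  have htr : Matrix.trace
      (!![e, f; g, -e] * (!![a, b; c, d] * !![e, f; g, -e] * !![d, -b; -c, a])) =
      (a * (-g) + c * e) * (a * (-f) + b * e) + (b * (-g) + d * e) * (a * e + b * g) +
      (a * e + c * f) * (c * (-f) + d * e) + (b * e + d * f) * (c * e + d * g) := by
    simp [Matrix.trace_fin_two]
    ring
  rw [htr, abs_lt]
  constructor <;> linarith [p1.1, p1.2, p2.1, p2.2, p3.1, p3.2, p4.1, p4.2]

namespace Matrix.SpecialLinearGroup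

theorem coe_inv_fin_two (A : SL(2, ℝ)) :
    (A⁻¹).val = !![A 1 1, -A 0 1; -A 1 0, A 0 0] := by
  rw [coe_inv, adjugate_fin_two]

theorem trace_mul_comm (A B : SL(2, ℝ)) : (A * B).val.trace = (B * A).val.trace := by
  simpa only [coe_mul] using Matrix.trace_mul_comm A.val B.val

theorem trace_mul (A B : SL(2, ℝ)) :
    (A * B).val.trace = A.val.trace * B.val.trace - (A * B⁻¹).val.trace := by
  rw [coe_mul, coe_mul, coe_inv_fin_two]
  simp [trace_fin_two, mul_apply]
  ring

theorem trace_inv (A : SL(2, ℝ)) : (A⁻¹).val.trace = A.val.trace := by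
  rw [coe_inv_fin_two]
  simp [trace_fin_two, add_comm]

theorem trace_mul_self (A : SL(2, ℝ)) : (A * A).val.trace = A.val.trace ^ 2 - 2 := by
  rw [trace_mul, mul_inv_cancel, coe_one, trace_one, Fintype.card_fin]
  push_cast
  ring

theorem trace_commutator (A B : SL(2, ℝ)) :
    (A * B * A⁻¹ * B⁻¹).val.trace = A.val.trace ^ 2 + B.val.trace ^ 2 + (A * B).val.trace ^ 2 -
      A.val.trace * B.val.trace * (A * B).val.trace - 2 := by
  have h1 := trace_mul (A * B) (B * A)
  have h2 : A * B * (B * A)⁻¹ = A * B * A⁻¹ * B⁻¹ := by group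
  have h3 := trace_mul (B * B * A) A
  have h4 := trace_mul (A * B) B
  rw [mul_inv_cancel_right] at h3 h4
  rw [h2, show A * B * (B * A) = A * (B * B * A) by simp only [mul_assoc], trace_mul_comm A, h3,
    trace_mul_comm (B * B), ← mul_assoc, h4, trace_mul_self, trace_mul_comm B A] at h1
  linarith

end Matrix.SpecialLinearGroup

/-- In a group all of whose elements other than `±1` are hyperbolic, let `B` and `C` have the same
trace `T`. If `T` is small and the traceless parts of `B` and `C` have a small pairing, then `B * C`
or `B * C⁻¹` is `±1`, since these two and the commutator of `B` and `C` cannot all be hyperbolic. -/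
theorem eq_or_eq_neg_or_eq_inv_of_trace_eq {G : Subgroup SL(2, ℝ)}
    (hG : ∀ g ∈ G, g = 1 ∨ g = -1 ∨ 4 < g.val.trace ^ 2) {B C : SL(2, ℝ)} (hB : B ∈ G)
    (hC : C ∈ G) (htr : C.val.trace = B.val.trace) (hhyp : 4 < B.val.trace ^ 2)
    (hN : B.val.trace ^ 2 < 8) (hU : |(B * C).val.trace - B.val.trace ^ 2 / 2| < 4) :
    (B = C ∨ B = -C) ∨ (B = C⁻¹ ∨ B = -C⁻¹) := by
  have hsum := Matrix.SpecialLinearGroup.trace_mul B C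
  have hcomm := Matrix.SpecialLinearGroup.trace_commutator B C
  rw [htr] at hsum hcomm
  have t1 : (1 : SL(2, ℝ)).val.trace = 2 := by simp
  have t2 : (-1 : SL(2, ℝ)).val.trace = -2 := by simp
  obtain ⟨hU1, hU2⟩ := abs_lt.mp hU
  set u := (B * C).val.trace
  set T := B.val.trace
  -- the traces of `B * C` and `B * C⁻¹` add up to `T ^ 2 > 4` and both exceed `-2`; if both exceed
  -- `2`, the commutator has trace in `(-2, 2)`
  by_cases h1 : u ≤ 2
  · rcases hG _ (mul_mem hB hC) with h | h | h
    · exact .inr (.inl (eq_inv_of_mul_eq_one_left h))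
    · refine .inr (.inr (neg_eq_iff_eq_neg.mp (eq_inv_of_mul_eq_one_left ?_)))
      rw [neg_mul, h, neg_neg]
    · nlinarith
  by_cases h2 : (B * C⁻¹).val.trace ≤ 2
  · rcases hG _ (mul_mem hB (inv_mem hC)) with h | h | h
    · exact .inl (.inl (mul_inv_eq_one.mp h))
    · exact .inl (.inr (by rw [← neg_eq_iff_eq_neg, ← mul_inv_eq_one, neg_mul, h, neg_neg]))
    · nlinarith
  exfalso
  have key : (B * C * B⁻¹ * C⁻¹).val.trace < 2 ∧ -2 < (B * C * B⁻¹ * C⁻¹).val.trace := by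
    rw [hcomm]
    constructor <;> nlinarith [sq_nonneg (u - T ^ 2 / 2)]
  rcases hG _ (mul_mem (mul_mem (mul_mem hB hC) (inv_mem hB)) (inv_mem hC)) with h | h | h
  · rw [h, t1] at key; linarith [key.1]
  · rw [h, t2] at key; linarith [key.2]
  · nlinarith

/-- The hypotheses on the entries bound `sinh (d / 2)`, for the displacement `d` of `I`, by `1` for
`A` and by `√2 - 1` for `B`. -/
theorem mul_comm_of_displacement_I_small {G : Subgroup SL(2, ℝ)}
    (hG : ∀ g ∈ G, g = 1 ∨ g = -1 ∨ 4 < g.val.trace ^ 2) {A B : SL(2, ℝ)} (hA : A ∈ G)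
    (hB : B ∈ G) (hdA : (A 0 0 - A 1 1) ^ 2 + (A 0 1 + A 1 0) ^ 2 ≤ 4)
    (hdB : (B 0 0 - B 1 1) ^ 2 + (B 0 1 + B 1 0) ^ 2 < 4 * (3 - 2 * √2)) : A * B = B * A := by
  rcases hG A hA with rfl | rfl | hAt
  · simp
  · simp
  rcases hG B hB with rfl | rfl | hBt
  · simp
  · simp
  have detA := A.det_coe
  have detB := B.det_coe
  rw [Matrix.det_fin_two] at detA detB
  have htr : (A * B * A⁻¹).val.trace = B.val.trace := by
    rw [Matrix.SpecialLinearGroup.trace_mul_comm, inv_mul_cancel_left]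
  have hs2 : 1 < √2 := by
    rw [Real.lt_sqrt] <;> norm_num
  have hN : B.val.trace ^ 2 < 8 := by
    rw [Matrix.trace_fin_two]
    nlinarith [sq_nonneg (B 0 1 - B 1 0)]
  have hU : |(B * (A * B * A⁻¹)).val.trace - B.val.trace ^ 2 / 2| < 4 := by
    have := abs_trace_mul_conj_lt (a := A 0 0) (b := A 0 1) (c := A 1 0) (d := A 1 1)
      (e := (B 0 0 - B 1 1) / 2) (f := B 0 1) (g := B 1 0) detA (by linarith) (by linarith) (by
        rw [Matrix.trace_fin_two] at hBt
        linarith)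
    refine lt_of_eq_of_lt (congrArg abs ?_) this
    simp only [Matrix.SpecialLinearGroup.coe_mul, Matrix.SpecialLinearGroup.coe_inv_fin_two]
    simp only [Matrix.trace_fin_two, Matrix.mul_apply, Fin.sum_univ_two]
    simp
    linear_combination ((B 0 0 + B 1 1) ^ 2 / 2) * detA
  rcases eq_or_eq_neg_or_eq_inv_of_trace_eq hG hB (mul_mem (mul_mem hA hB) (inv_mem hA)) htr hBt hN
    hU with (h | h) | (h | h)
  · rw [h]; nth_rw 1 [← h]; group
  · exfalso
    have := congrArg (fun g : SL(2, ℝ) => g.val.trace) h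
    simp only [Matrix.SpecialLinearGroup.coe_neg, Matrix.trace_neg, htr] at this
    nlinarith
  -- if `A` conjugates `B` to `B⁻¹`, then `(A * B) ^ 2 = A ^ 2`, and comparing traces gives
  -- `B.val.trace ^ 2 = 4`
  · exfalso
    have h1 : B * A = A * B⁻¹ := by
      nth_rw 1 [h]; group
    have h2 : A * B * (A * B) = A * A := by
      rw [mul_assoc, ← mul_assoc B, h1, inv_mul_cancel_right]
    have h3 := Matrix.SpecialLinearGroup.trace_mul A B
    rw [← h1, ← Matrix.SpecialLinearGroup.trace_mul_comm A B] at h3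
    have h4 := Matrix.SpecialLinearGroup.trace_mul_self (A * B)
    rw [h2, Matrix.SpecialLinearGroup.trace_mul_self] at h4
    have h5 : (2 * (A * B).val.trace) ^ 2 = A.val.trace ^ 2 * B.val.trace ^ 2 := by
      rw [← mul_pow]; congr 1; linarith
    have h6 := mul_pos (sub_pos.mpr hAt) (sub_pos.mpr hBt)
    linarith
  · exfalso
    have := congrArg (fun g : SL(2, ℝ) => g.val.trace) h
    simp only [Matrix.SpecialLinearGroup.coe_neg, Matrix.trace_neg,
      Matrix.SpecialLinearGroup.trace_inv, htr] at this
    nlinarith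

/-- A form of the Margulis lemma: in a group without elliptic and parabolic elements, two elements
that displace a point `w` by little commute. -/
theorem commute_of_dist_smul_lt {Γ : Subgroup SL(2, ℝ)}
    (hΓ : ∀ g ∈ Γ, g = 1 ∨ g = -1 ∨ 4 < g.val.trace ^ 2) {A B : SL(2, ℝ)} (hA : A ∈ Γ)
    (hB : B ∈ Γ) (w : ℍ) (hdA : dist w (A • w) ≤ 2 * Real.arsinh 1)
    (hdB : Real.sinh (dist w (B • w) / 2) < √2 - 1) : A * B = B * A := by
  set g := w.toSL2R
  have hg : g • UpperHalfPlane.I = w := UpperHalfPlane.toSL2R_smul_I w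
  have hdist (C : SL(2, ℝ)) : dist UpperHalfPlane.I ((g⁻¹ * C * g) • UpperHalfPlane.I) =
      dist w (C • w) := by
    rw [mul_smul, mul_smul, hg, ← dist_smul g, smul_inv_smul, hg]
  have hmem {C : SL(2, ℝ)} (hC : C ∈ Γ) :
      g⁻¹ * C * g ∈ Γ.map (MulAut.conj g⁻¹).toMonoidHom :=
    ⟨C, hC, by simp⟩
  have hG : ∀ h ∈ Γ.map (MulAut.conj g⁻¹).toMonoidHom,
      h = 1 ∨ h = -1 ∨ 4 < h.val.trace ^ 2 := by
    rintro _ ⟨C, hC, rfl⟩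
    have : (MulAut.conj g⁻¹).toMonoidHom C = g⁻¹ * C * g := by simp
    rw [this]
    rcases hΓ C hC with rfl | rfl | h
    · simp
    · simp
    · right; right
      rwa [Matrix.SpecialLinearGroup.trace_mul_comm, mul_inv_cancel_left]
  have hsq : √2 ^ 2 = 2 := Real.sq_sqrt (by norm_num)
  have key : (g⁻¹ * A * g) * (g⁻¹ * B * g) = (g⁻¹ * B * g) * (g⁻¹ * A * g) := by
    refine mul_comm_of_displacement_I_small hG (hmem hA) (hmem hB) ?_ ?_
    · rw [← sq_sinh_half_dist_I_smul, hdist]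
      have h1 : Real.sinh (dist w (A • w) / 2) ≤ 1 := by
        rw [← Real.sinh_arsinh 1, Real.sinh_le_sinh]
        linarith
      have h0 : 0 ≤ Real.sinh (dist w (A • w) / 2) := Real.sinh_nonneg_iff.mpr (by positivity)
      nlinarith
    · rw [← sq_sinh_half_dist_I_smul, hdist]
      have h0 : 0 ≤ Real.sinh (dist w (B • w) / 2) := Real.sinh_nonneg_iff.mpr (by positivity)
      nlinarith
  have h1 : g⁻¹ * (A * B) * g = g⁻¹ * (B * A) * g := by
    simpa [mul_assoc] using key
  exact mul_left_cancel (mul_right_cancel h1)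

/-! ### Elements other than `±1` are hyperbolic -/

theorem eq_one_or_eq_neg_one_of_smul_eq {A : SL(2, ℝ)} (h : ∀ z : ℍ, A • z = z) :
    A = 1 ∨ A = -1 := by
  have hQ (z : ℍ) : (A 1 0 * (z : ℂ) ^ 2 + (A 1 1 - A 0 0) * z - A 0 1 : ℂ) = 0 := by
    have := sinh_half_dist_smul A z
    rw [h z, dist_self, zero_div, Real.sinh_zero, eq_comm, div_eq_zero_iff, norm_eq_zero] at this
    exact this.resolve_right (by have := z.im_pos; positivity)
  have h1 := hQ UpperHalfPlane.I
  have h2 := hQ ⟨2 * Complex.I, by simp⟩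
  simp [Complex.ext_iff, sq] at h1 h2
  have hdet := A.det_coe
  rw [Matrix.det_fin_two] at hdet
  have hc : A 1 0 = 0 := by linarith
  have hb : A 0 1 = 0 := by linarith
  have hd : A 1 1 = A 0 0 := by linarith
  rw [hc, hd] at hdet
  have : A 0 0 = 1 ∨ A 0 0 = -1 := mul_self_eq_one_iff.mp (by linarith)
  rcases this with ha | ha
  · left
    ext i j
    fin_cases i <;> fin_cases j <;> simp [ha, hb, hc, hd]
  · right
    ext i j
    fin_cases i <;> fin_cases j <;> simp [ha, hb, hc, hd]

theorem exists_smul_eq_of_trace_sq_lt {A : SL(2, ℝ)} (h : A.val.trace ^ 2 < 4) :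
    ∃ z : ℍ, A • z = z := by
  have hdet := A.det_coe
  rw [Matrix.det_fin_two] at hdet
  rw [Matrix.trace_fin_two] at h
  have hc : A 1 0 ≠ 0 := by
    intro hc
    rw [hc] at hdet
    nlinarith [sq_nonneg (A 0 0 - A 1 1)]
  have hD : 0 < 4 - (A 0 0 + A 1 1) ^ 2 := by linarith
  have hs := Real.sq_sqrt hD.le
  have hspos := Real.sqrt_pos.mpr hD
  set s := √(4 - (A 0 0 + A 1 1) ^ 2)
  let z : ℍ := ⟨⟨(A 0 0 - A 1 1) / (2 * A 1 0), s / (2 * |A 1 0|)⟩, by positivity⟩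
  refine ⟨z, ?_⟩
  have hQ : (A 1 0 * (z : ℂ) ^ 2 + (A 1 1 - A 0 0) * z - A 0 1 : ℂ) = 0 := by
    have ha : |A 1 0| ^ 2 = A 1 0 ^ 2 := sq_abs _
    have ha0 : |A 1 0| ≠ 0 := abs_ne_zero.mpr hc
    simp only [z, Complex.ext_iff, sq]
    simp
    constructor
    · field_simp
      rw [ha, hs]
      linear_combination 4 * A 1 0^2 * hdet
    · field_simp
      ring
  have := sinh_half_dist_smul A z
  rw [hQ, norm_zero, zero_div, Real.sinh_eq_zero] at this
  exact (dist_eq_zero.mp (by linarith)).symm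

/-- An element of trace `±2` has arbitrarily small displacements, near a fixed point at infinity. -/
theorem exists_dist_smul_lt_of_trace_sq_eq {A : SL(2, ℝ)} (h : A.val.trace ^ 2 = 4)
    {ε : ℝ} (hε : 0 < ε) : ∃ z : ℍ, dist z (A • z) < ε := by
  have hdet := A.det_coe
  rw [Matrix.det_fin_two] at hdet
  rw [Matrix.trace_fin_two] at h
  have hδ : 0 < Real.sinh (ε / 2) := Real.sinh_pos_iff.mpr (by linarith)
  set δ := Real.sinh (ε / 2)
  suffices ∃ z : ℍ, ‖(A 1 0 * (z : ℂ) ^ 2 + (A 1 1 - A 0 0) * z - A 0 1 : ℂ)‖ < δ * (2 * z.im) by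
    obtain ⟨z, hz⟩ := this
    refine ⟨z, ?_⟩
    rw [← div_lt_iff₀ (by have := z.im_pos; positivity), ← sinh_half_dist_smul,
      Real.sinh_lt_sinh] at hz
    linarith
  by_cases hc : A 1 0 = 0
  · have had : A 1 1 = A 0 0 := by
      rw [hc] at hdet
      nlinarith [sq_nonneg (A 0 0 - A 1 1)]
    refine ⟨⟨⟨0, (|A 0 1| + 1) / δ⟩, by positivity⟩, ?_⟩
    rw [hc, had]
    simp
    field_simp
    linarith [abs_nonneg (A 0 1)]
  · have hc' : 0 < |A 1 0| := abs_pos.mpr hc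
    refine ⟨⟨⟨(A 0 0 - A 1 1) / (2 * A 1 0), δ / |A 1 0|⟩, by positivity⟩, ?_⟩
    have : (A 1 0 * (⟨(A 0 0 - A 1 1) / (2 * A 1 0), δ / |A 1 0|⟩ : ℂ) ^ 2 + (A 1 1 - A 0 0) *
        (⟨(A 0 0 - A 1 1) / (2 * A 1 0), δ / |A 1 0|⟩ : ℂ) - A 0 1 : ℂ) =
        ((-(A 1 0 * (δ / |A 1 0|) ^ 2) : ℝ) : ℂ) := by
      simp only [Complex.ext_iff, sq]
      simp
      constructor
      · field_simp
        rw [sq_abs]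
        linear_combination A 1 0 ^ 2 * (4 * hdet - h)
      · field_simp
        ring
    simp only [this]
    rw [Complex.norm_real, norm_neg, norm_mul, norm_pow, norm_div]
    simp only [Real.norm_eq_abs, abs_abs, abs_of_pos hδ]
    change |A 1 0| * (δ / |A 1 0|) ^ 2 < δ * (2 * (δ / |A 1 0|))
    field_simp
    nlinarith

/-- An element that acts freely or trivially, with displacements bounded away from `0`, is `±1` or
hyperbolic. -/
theorem four_lt_trace_sq_of_le_dist_smul {A : SL(2, ℝ)}
    (hfree : ∀ z : ℍ, A • z = z → ∀ w : ℍ, A • w = w) {ε : ℝ} (hε : 0 < ε)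
    (hdist : ∀ z : ℍ, A • z ≠ z → ε ≤ dist z (A • z)) :
    A = 1 ∨ A = -1 ∨ 4 < A.val.trace ^ 2 := by
  by_contra! hcon
  have hne (z : ℍ) : A • z ≠ z := fun hz =>
    (eq_one_or_eq_neg_one_of_smul_eq (hfree z hz)).elim hcon.1 hcon.2.1
  rcases hcon.2.2.lt_or_eq with h | h
  · obtain ⟨z, hz⟩ := exists_smul_eq_of_trace_sq_lt h
    exact hne z hz
  · obtain ⟨z, hz⟩ := exists_dist_smul_lt_of_trace_sq_eq h hε
    exact absurd (hdist z (hne z)) (not_le.mpr hz)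

/-! ### Commuting elements and squares -/

/-- The displacement functions of commuting elements are comparable: the order of their values is
the same at all points, as their traceless parts are proportional. -/
theorem dist_smul_le_dist_smul_of_commute {A B : SL(2, ℝ)} (h : A * B = B * A) {z : ℍ}
    (hz : A • z ≠ z) (hle : dist z (A • z) ≤ dist z (B • z)) (w : ℍ) :
    dist w (A • w) ≤ dist w (B • w) := by
  have hpos : 0 < Real.sinh (dist z (A • z) / 2) :=
    Real.sinh_pos_iff.mpr (half_pos (dist_pos.mpr hz.symm))
  obtain ⟨μ, h1, h2, h3⟩ : ∃ μ : ℝ, B 1 0 = μ * A 1 0 ∧ B 1 1 - B 0 0 = μ * (A 1 1 - A 0 0) ∧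
      B 0 1 = μ * A 0 1 := by
    have hmat := congrArg (fun g : SL(2, ℝ) => g.val) h
    simp only [Matrix.SpecialLinearGroup.coe_mul] at hmat
    have e00 := congrFun (congrFun hmat 0) 0
    have e01 := congrFun (congrFun hmat 0) 1
    have e10 := congrFun (congrFun hmat 1) 0
    simp only [Matrix.mul_apply, Fin.sum_univ_two] at e00 e01 e10
    by_cases hc : A 1 0 = 0
    · by_cases hd : A 1 1 - A 0 0 = 0
      · by_cases hb : A 0 1 = 0
        · exfalso
          rw [sinh_half_dist_smul, ← Complex.ofReal_sub, hc, hd, hb] at hpos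
          simp at hpos
        · refine ⟨B 0 1 / A 0 1, ?_, ?_, ?_⟩ <;> field_simp <;> linarith
      · refine ⟨(B 1 1 - B 0 0) / (A 1 1 - A 0 0), ?_, ?_, ?_⟩ <;> field_simp <;> linarith
    · refine ⟨B 1 0 / A 1 0, ?_, ?_, ?_⟩ <;> field_simp <;> linarith
  have hμ (v : ℍ) : Real.sinh (dist v (B • v) / 2) = |μ| * Real.sinh (dist v (A • v) / 2) := by
    rw [sinh_half_dist_smul, sinh_half_dist_smul, ← mul_div_assoc, ← Real.norm_eq_abs,
      ← Complex.norm_real, ← norm_mul, ← Complex.ofReal_sub, h1, h2, h3]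
    push_cast
    ring_nf
  have hμ1 : 1 ≤ |μ| := by
    have : Real.sinh (dist z (A • z) / 2) ≤ Real.sinh (dist z (B • z) / 2) :=
      Real.sinh_le_sinh.mpr (by linarith)
    rw [hμ] at this
    exact le_of_mul_le_mul_right (by linarith) hpos
  have : Real.sinh (dist w (A • w) / 2) ≤ Real.sinh (dist w (B • w) / 2) := by
    rw [hμ]
    exact le_mul_of_one_le_left (Real.sinh_nonneg_iff.mpr (by positivity)) hμ1
  rw [Real.sinh_le_sinh] at this
  linarith

/-- By the Cayley–Hamilton theorem the traceless part of `A * A` is `A.val.trace` times that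
of `A`. -/
theorem sinh_half_dist_smul_smul (A : SL(2, ℝ)) (z : ℍ) :
    Real.sinh (dist z (A • A • z) / 2) = |A.val.trace| * Real.sinh (dist z (A • z) / 2) := by
  have hdet := congrArg (fun x : ℝ => (x : ℂ)) A.det_coe
  simp only [Matrix.det_fin_two] at hdet
  rw [smul_smul, sinh_half_dist_smul, sinh_half_dist_smul, ← mul_div_assoc, ← Real.norm_eq_abs,
    ← Complex.norm_real, ← norm_mul, Matrix.trace_fin_two]
  simp only [Matrix.SpecialLinearGroup.coe_mul, Matrix.mul_apply, Fin.sum_univ_two]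
  push_cast
  ring_nf

/-! ### Estimates for the hyperbolic sine -/

theorem Real.convexOn_sinh : ConvexOn ℝ (Set.Ici 0) Real.sinh := by
  refine convexOn_of_deriv2_nonneg (convex_Ici 0) Real.continuous_sinh.continuousOn
    Real.differentiable_sinh.differentiableOn ?_ ?_
  · rw [Real.deriv_sinh]
    exact Real.differentiable_cosh.differentiableOn
  · intro x hx
    rw [interior_Ici, Set.mem_Ioi] at hx
    simpa using hx.le

theorem sinh_sqrt_two_mul_le {x : ℝ} (hx0 : 0 ≤ x) (hx : x ≤ Real.arsinh 1) :
    Real.sinh (√2 * x) ≤ 2 * Real.sinh x := by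
  have hsq : √2 ^ 2 = 2 := Real.sq_sqrt (by norm_num)
  have h1 : 1.4 ≤ √2 := Real.le_sqrt_of_sq_le (by norm_num)
  have h2 : √2 ≤ 1.5 := Real.sqrt_le_iff.mpr (by norm_num)
  have hs0 : 0 ≤ Real.sinh x := Real.sinh_nonneg_iff.mpr hx0
  have hs1 : Real.sinh x ≤ 1 := by rwa [← Real.sinh_arsinh 1, Real.sinh_le_sinh]
  have hc : Real.cosh x ≤ √2 := by
    apply Real.le_sqrt_of_sq_le
    rw [Real.cosh_sq]
    nlinarith
  -- `√2 x` is a convex combination of `x` and `2 x`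
  have hconv := Real.convexOn_sinh.2 (Set.mem_Ici.mpr hx0)
    (Set.mem_Ici.mpr (by linarith : 0 ≤ 2 * x)) (by linarith : 0 ≤ 2 - √2)
    (by linarith : 0 ≤ √2 - 1) (by ring)
  simp only [smul_eq_mul, Real.sinh_two_mul] at hconv
  rw [show (2 - √2) * x + (√2 - 1) * (2 * x) = √2 * x by ring] at hconv
  have h3 : (√2 - 1) * Real.cosh x ≤ 2 - √2 := by nlinarith
  nlinarith [mul_le_mul_of_nonneg_left h3 hs0]

theorem sinh_lt_of_lt_mul_arsinh_one {x : ℝ} (hx : x < (√2 - 1) * Real.arsinh 1) :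
    Real.sinh x < √2 - 1 := by
  have h1 : 1 ≤ √2 := Real.one_le_sqrt.mpr (by norm_num)
  have h2 : √2 ≤ 2 := Real.sqrt_le_iff.mpr (by norm_num)
  refine (Real.sinh_lt_sinh.mpr hx).trans_le ?_
  have hconv := Real.convexOn_sinh.2 (Set.mem_Ici.mpr le_rfl)
    (Set.mem_Ici.mpr (Real.arsinh_nonneg_iff.mpr zero_le_one)) (by linarith : 0 ≤ 2 - √2)
    (by linarith : 0 ≤ √2 - 1) (by ring)
  simpa using hconv

/-! ### Quotients of the hyperbolic plane -/

/-- `π` is the quotient map of `ℍ` by a group `Γ` acting freely and properly discontinuously, onto a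
space with the quotient distance. Since `-1 ∈ Γ` is allowed, freeness says that an element
with a fixed point acts as the identity. -/
structure IsFuchsianQuotientMap {X : Type*} [MetricSpace X] (Γ : Subgroup SL(2, ℝ)) (π : ℍ → X) :
    Prop where
  properlyDiscontinuous : ProperlyDiscontinuousSMul Γ ℍ
  free : ∀ (γ : Γ) (z : ℍ), γ • z = z → ∀ w : ℍ, γ • w = w
  surjective : Function.Surjective π
  apply_eq_iff : ∀ z w : ℍ, π z = π w ↔ ∃ γ : Γ, γ • z = w
  dist_eq : ∀ z w : ℍ, dist (π z) (π w) = ⨅ γ : Γ, dist z (γ • w)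

namespace IsFuchsianQuotientMap

variable {X : Type*} [MetricSpace X] {Γ : Subgroup SL(2, ℝ)} {π : ℍ → X}

theorem apply_smul (h : IsFuchsianQuotientMap Γ π) (γ : Γ) (z : ℍ) : π (γ • z) = π z :=
  ((h.apply_eq_iff z _).mpr ⟨γ, rfl⟩).symm

theorem dist_apply_le (h : IsFuchsianQuotientMap Γ π) (z w : ℍ) : dist (π z) (π w) ≤ dist z w := by
  rw [h.dist_eq]
  refine (ciInf_le ⟨0, ?_⟩ 1).trans_eq (by rw [one_smul])
  rintro _ ⟨γ, rfl⟩
  exact dist_nonneg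

theorem continuous (h : IsFuchsianQuotientMap Γ π) : Continuous π :=
  (LipschitzWith.of_dist_le_mul (K := 1) fun z w => by simpa using h.dist_apply_le z w).continuous

theorem exists_apply_eq_of_dist_lt (h : IsFuchsianQuotientMap Γ π) {z : ℍ} {x : X} {r : ℝ}
    (hx : dist (π z) x < r) : ∃ w, dist z w < r ∧ π w = x := by
  obtain ⟨w, rfl⟩ := h.surjective x
  rw [h.dist_eq] at hx
  obtain ⟨γ, hγ⟩ := exists_lt_of_ciInf_lt hx
  exact ⟨γ • w, hγ, h.apply_smul γ w⟩

theorem isOpenMap (h : IsFuchsianQuotientMap Γ π) : IsOpenMap π := by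
  intro U hU
  rw [Metric.isOpen_iff] at hU ⊢
  rintro _ ⟨z, hz, rfl⟩
  obtain ⟨r, hr, hrU⟩ := hU z hz
  refine ⟨r, hr, fun x hx => ?_⟩
  obtain ⟨w, hw, rfl⟩ := h.exists_apply_eq_of_dist_lt (by rwa [Metric.mem_ball, dist_comm] at hx)
  exact ⟨w, hrU (by rwa [Metric.mem_ball, dist_comm]), rfl⟩

/-- An element moving a point of a small enough ball to a point of the same ball is trivial. -/
theorem exists_ball_smul_eq (h : IsFuchsianQuotientMap Γ π) (z : ℍ) :
    ∃ r > 0, ∀ (γ : Γ) (u : ℍ), u ∈ Metric.ball z r → γ • u ∈ Metric.ball z r →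
      ∀ w : ℍ, γ • w = w := by
  have := h.properlyDiscontinuous
  obtain ⟨U, hU, hγ⟩ := ProperlyDiscontinuousSMul.exists_nhds_image_smul_eq_self Γ z
  obtain ⟨r, hr, hrU⟩ := Metric.mem_nhds_iff.mp hU
  exact ⟨r, hr, fun γ u hu hγu =>
    h.free γ z (hγ γ ⟨γ • u, ⟨u, hrU hu, rfl⟩, hrU hγu⟩)⟩

theorem isCoveringMap (h : IsFuchsianQuotientMap Γ π) : IsCoveringMap π := by
  -- `-1` may belong to `Γ`, so the free action is that of the image of `Γ` in the permutations
  let G : Subgroup (Equiv.Perm ℍ) := (MulAction.toPermHom Γ ℍ).range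
  have hcont : ContinuousConstSMul G ℍ := ⟨by
    rintro ⟨_, γ, rfl⟩
    exact continuous_const_smul γ⟩
  have hq : Topology.IsQuotientMap π := h.isOpenMap.isQuotientMap h.continuous h.surjective
  have hG {e₁ e₂ : ℍ} : π e₁ = π e₂ ↔ e₁ ∈ MulAction.orbit G e₂ := by
    rw [eq_comm, h.apply_eq_iff]
    constructor
    · rintro ⟨γ, rfl⟩
      exact ⟨⟨_, γ, rfl⟩, rfl⟩
    · rintro ⟨⟨_, γ, rfl⟩, rfl⟩
      exact ⟨γ, rfl⟩
  have hcov := hq.isCoveringMapOn_of_smul_disjoint (G := G) (fun {_ _} => hG) fun e => by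
    obtain ⟨r, hr, hγ⟩ := h.exists_ball_smul_eq e
    refine ⟨Metric.ball e r, Metric.ball_mem_nhds e hr, ?_⟩
    rintro ⟨_, γ, rfl⟩ ⟨_, ⟨u, hu, rfl⟩, hu'⟩
    exact hγ γ u hu hu' e
  rw [isCoveringMap_iff_isCoveringMapOn_univ]
  refine hcov.mono fun x _ => ?_
  obtain ⟨z, rfl⟩ := h.surjective x
  refine ⟨z, ?_, rfl⟩
  rw [Set.mem_ofPred_eq, eq_bot_iff]
  rintro ⟨_, γ, rfl⟩ hγ
  rw [Subgroup.mem_bot]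
  ext1
  exact Equiv.ext (h.free γ z hγ)

theorem exists_ball_dist_apply_eq (h : IsFuchsianQuotientMap Γ π) (z : ℍ) :
    ∃ r > 0, ∀ u ∈ Metric.ball z r, ∀ v ∈ Metric.ball z r, dist (π u) (π v) = dist u v := by
  obtain ⟨r, hr, hγ⟩ := h.exists_ball_smul_eq z
  refine ⟨r / 3, by positivity, fun u hu v hv => (h.dist_apply_le u v).antisymm ?_⟩
  rw [h.dist_eq]
  refine le_ciInf fun γ => ?_
  by_contra! hlt
  rw [Metric.mem_ball] at hu hv
  have h1 : dist (γ • v) z < r := by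
    have := dist_triangle_left (γ • v) z u
    have := dist_triangle_right u v z
    linarith
  rw [hγ γ v (Metric.mem_ball.mpr (by linarith)) h1 v] at hlt
  exact lt_irrefl _ hlt

/-- On a compact quotient the displacements of nontrivial elements are bounded away from `0`. -/
theorem exists_pos_le_dist_smul [CompactSpace X] (h : IsFuchsianQuotientMap Γ π) :
    ∃ ε > 0, ∀ (γ : Γ) (z : ℍ), γ • z ≠ z → ε ≤ dist z (γ • z) := by
  choose r hr hγ using h.exists_ball_smul_eq
  obtain ⟨t, ht⟩ := isCompact_univ.elim_finite_subcover
    (fun z : ℍ => π '' Metric.ball z (r z / 2)) (fun z => h.isOpenMap _ Metric.isOpen_ball)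
    (fun x _ => by
      obtain ⟨z, rfl⟩ := h.surjective x
      exact Set.mem_iUnion.mpr ⟨z, z, Metric.mem_ball_self (half_pos (hr z)), rfl⟩)
  have htne : t.Nonempty := by
    obtain ⟨z, hz, -⟩ := Set.mem_iUnion₂.mp (ht (Set.mem_univ (π UpperHalfPlane.I)))
    exact ⟨z, hz⟩
  refine ⟨t.inf' htne fun z => r z / 2, ?_, fun γ z hz => ?_⟩
  · rw [gt_iff_lt, Finset.lt_inf'_iff]
    exact fun z _ => half_pos (hr z)
  · obtain ⟨c, hc, u, hu, huz⟩ := Set.mem_iUnion₂.mp (ht (Set.mem_univ (π z)))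
    refine (Finset.inf'_le _ hc).trans ?_
    by_contra! hlt
    obtain ⟨η, rfl⟩ := (h.apply_eq_iff u z).mp huz
    have hiso (η : Γ) (v w : ℍ) : dist (η • v) (η • w) = dist v w := dist_smul (η : SL(2, ℝ)) v w
    have h1 : dist u ((η⁻¹ * γ * η) • u) < r c / 2 := by
      rwa [mul_smul, mul_smul, ← hiso η, smul_inv_smul]
    have h2 : (η⁻¹ * γ * η) • u ∈ Metric.ball c (r c) := by
      rw [Metric.mem_ball] at hu ⊢
      have := dist_triangle_left ((η⁻¹ * γ * η) • u) c u
      linarith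
    have h3 := hγ c _ u (Metric.ball_subset_ball (by linarith [hr c]) hu) h2 u
    rw [mul_smul, mul_smul, inv_smul_eq_iff] at h3
    exact hz h3

theorem eq_one_or_neg_one_or_four_lt_trace_sq [CompactSpace X]
    (h : IsFuchsianQuotientMap Γ π) :
    ∀ g ∈ Γ, g = 1 ∨ g = -1 ∨ 4 < g.val.trace ^ 2 := by
  intro g hg
  obtain ⟨ε, hε, hdist⟩ := h.exists_pos_le_dist_smul
  exact four_lt_trace_sq_of_le_dist_smul (h.free ⟨g, hg⟩) hε (hdist ⟨g, hg⟩)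

end IsFuchsianQuotientMap

/-! ### Geodesics of the hyperbolic plane -/

/-- A path whose speed is locally at most `1` moves a distance of at most `b - a`. -/
theorem dist_le_sub_of_locally {Y : Type*} [PseudoMetricSpace Y] {f : ℝ → Y} {a b : ℝ}
    (hab : a ≤ b) (hf : ContinuousOn f (Set.Icc a b))
    (hloc : ∀ s ∈ Set.Icc a b, ∃ ε > 0, ∀ t ∈ Set.Icc a b, |t - s| < ε →
      dist (f s) (f t) ≤ |t - s|) :
    dist (f a) (f b) ≤ b - a := by
  have hclosed : IsClosed ({x | dist (f a) (f x) ≤ x - a} ∩ Set.Icc a b) := by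
    rw [Set.inter_comm]
    exact isClosed_Icc.isClosed_le ((continuous_const.dist continuous_id).comp_continuousOn hf)
      (continuous_id.sub continuous_const).continuousOn
  refine hclosed.Icc_subset_of_forall_mem_nhdsWithin (by simp) ?_ (Set.right_mem_Icc.mpr hab)
  rintro x ⟨hx : dist (f a) (f x) ≤ x - a, hxI⟩
  obtain ⟨ε, hε, h⟩ := hloc x (Set.Ico_subset_Icc_self hxI)
  filter_upwards [Ioo_mem_nhdsGT (show x < min b (x + ε) from lt_min hxI.2 (by linarith))]
    with y hy
  have hy1 := hy.2.trans_le (min_le_left _ _)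
  have hy2 := hy.2.trans_le (min_le_right _ _)
  have habs : |y - x| = y - x := abs_of_pos (by linarith [hy.1])
  have := h y ⟨by linarith [hxI.1, hy.1], hy1.le⟩ (by rw [habs]; linarith)
  rw [habs] at this
  have h3 := dist_triangle (f a) (f x) (f y)
  change dist (f a) (f y) ≤ y - a
  linarith

/-- Some rotation about `I` moves `w` onto the imaginary axis. For
`R = !![cos θ, sin θ; -sin θ, cos θ]` this holds if `(1 - |w| ^ 2) / 2 - i Re w` has argument
`2 * θ`. -/
theorem UpperHalfPlane.exists_smul_I_eq_and_re_eq_zero (w : ℍ) :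
    ∃ R : SL(2, ℝ), R • I = I ∧ (R • w).re = 0 := by
  set ζ : ℂ := ⟨(1 - Complex.normSq w) / 2, -w.re⟩ with hζ
  set θ := ζ.arg / 2
  have hcs := Real.sin_sq_add_cos_sq θ
  let R : SL(2, ℝ) := ⟨!![Real.cos θ, Real.sin θ; -Real.sin θ, Real.cos θ], by
    rw [Matrix.det_fin_two_of]; linarith⟩
  have hcoe (v : ℍ) : ((R • v : ℍ) : ℂ) =
      (Real.cos θ * v + Real.sin θ) / (-Real.sin θ * v + Real.cos θ) := by
    rw [coe_specialLinearGroup_apply]; simp [R]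
  refine ⟨R, ?_, ?_⟩
  · have h : Real.sinh (dist I (R • I) / 2) = 0 := by
      have := sq_sinh_half_dist_I_smul R
      simp [R] at this
      simpa using this
    rw [Real.sinh_eq_zero] at h
    exact (dist_eq_zero.mp (by linarith)).symm
  · have hre : ‖ζ‖ * Real.cos ζ.arg = (1 - Complex.normSq w) / 2 := Complex.norm_mul_cos_arg ζ
    have him : ‖ζ‖ * Real.sin ζ.arg = -w.re := Complex.norm_mul_sin_arg ζ
    have hz : Real.cos ζ.arg * w.re + Real.sin ζ.arg * ((1 - Complex.normSq w) / 2) = 0 := by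
      rcases eq_or_ne ‖ζ‖ 0 with h0 | h0
      · rw [h0, zero_mul] at hre him
        rw [← hre, neg_eq_zero.mp him.symm]; ring
      · apply mul_left_cancel₀ h0
        linear_combination w.re * hre + (1 - Complex.normSq w) / 2 * him
    have h2 : ζ.arg = 2 * θ := by ring
    rw [h2, Real.cos_two_mul, Real.sin_two_mul, Complex.normSq_apply] at hz
    rw [← coe_re, hcoe, Complex.div_re, ← add_div, div_eq_zero_iff]
    left
    generalize Real.cos θ = x at hz hcs ⊢
    generalize Real.sin θ = y at hz hcs ⊢
    simp at hz ⊢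
    linear_combination hz - w.re * hcs

theorem UpperHalfPlane.exists_isometry_zero_eq_dist_eq (z w : ℍ) :
    ∃ c : ℝ → ℍ, Isometry c ∧ c 0 = z ∧ c (dist z w) = w := by
  obtain ⟨g, hgI, hgw⟩ : ∃ g : SL(2, ℝ), g • I = z ∧ (g⁻¹ • w).re = 0 := by
    obtain ⟨R, hRI, hRw⟩ := exists_smul_I_eq_and_re_eq_zero (z.toSL2R⁻¹ • w)
    refine ⟨z.toSL2R * R⁻¹, ?_, ?_⟩
    · rw [mul_smul, inv_smul_eq_iff.mpr hRI.symm, toSL2R_smul_I]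
    · rwa [mul_inv_rev, inv_inv, mul_smul]
  obtain ⟨w', rfl⟩ : ∃ w', g • w' = w := ⟨g⁻¹ • w, smul_inv_smul g w⟩
  rw [inv_smul_smul] at hgw
  subst hgI
  rw [dist_smul]
  have hd : dist I w' = |Real.log w'.im| := by
    rw [dist_of_re_eq (by simp [hgw])]
    simp [Real.dist_eq]
  -- the vertical half-line from `I` through `w'`, traversed upwards or downwards
  obtain ⟨δ, hδ, hδd⟩ : ∃ δ : ℝ, |δ| = 1 ∧ δ * dist I w' = Real.log w'.im := by
    rw [hd]
    rcases abs_choice (Real.log w'.im) with h | h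
    · exact ⟨1, by simp, by rw [h, one_mul]⟩
    · exact ⟨-1, by simp, by rw [h]; ring⟩
  refine ⟨fun s => g • mk ⟨0, Real.exp (δ * s)⟩ (Real.exp_pos _), ?_, ?_, ?_⟩
  · refine Isometry.of_dist_eq fun s t => ?_
    rw [dist_smul]
    refine ((isometry_vertical_line 0).dist_eq (δ * s) (δ * t)).trans ?_
    rw [Real.dist_eq, Real.dist_eq, ← mul_sub, abs_mul, hδ, one_mul]
  · refine congrArg (g • ·) ?_
    ext1
    simp [Complex.ext_iff]
  · refine congrArg (g • ·) ?_
    ext1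
    rw [Complex.ext_iff]
    simp [hgw, hδd, Real.exp_log w'.im_pos]

/-! ### Geodesic loops and displacements -/

namespace IsFuchsianQuotientMap

variable {X : Type*} [MetricSpace X] {Γ : Subgroup SL(2, ℝ)} {π : ℍ → X}

/-- The geodesic segment from `z` to `γ • z` projects to a nontrivial loop, since the lift of a
contractible loop is closed. -/
theorem isNontrivialGeodesicLoop (h : IsFuchsianQuotientMap Γ π) {z : ℍ} {γ : Γ} (hγ : γ • z ≠ z) :
    ∃ σ : ℝ → X, IsNontrivialGeodesicLoop (π z) (dist z (γ • z)) σ := by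
  obtain ⟨c, hc, hc0, hcL⟩ := UpperHalfPlane.exists_isometry_zero_eq_dist_eq z (γ • z)
  set L := dist z (γ • z)
  have htarget : π (c L) = π z := by rw [hcL, h.apply_smul]
  let lift : C(unitInterval, ℍ) := ⟨fun t => c (L * t), hc.continuous.comp (by fun_prop)⟩
  refine ⟨fun t => π (c t), dist_pos.mpr hγ.symm, congrArg π hc0, htarget, fun s _ => ?_,
    ⟨⟨fun t => π (lift t), h.continuous.comp lift.continuous⟩, ?_, ?_⟩, fun t => rfl,
    fun hhom => ?_⟩
  · obtain ⟨r, hr, hiso⟩ := h.exists_ball_dist_apply_eq (c s)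
    refine ⟨r, hr, fun t _ u _ ht hu => ?_⟩
    rw [hiso _ (by rwa [Metric.mem_ball, hc.dist_eq]) _ (by rwa [Metric.mem_ball, hc.dist_eq]),
      hc.dist_eq, Real.dist_eq]
  · simp [lift, hc0]
  · simpa [lift] using htarget
  · have key := h.isCoveringMap.liftPath_apply_one_eq_of_homotopicRel hhom z
      (congrArg π (by simp [lift, hc0])) rfl
    have h1 : lift = h.isCoveringMap.liftPath
        ⟨fun t => π (lift t), h.continuous.comp lift.continuous⟩ z
        (congrArg π (by simp [lift, hc0])) :=
      (h.isCoveringMap.eq_liftPath_iff' (congrArg π (by simp [lift, hc0]))).mpr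
        ⟨rfl, by simp [lift, hc0]⟩
    have h2 := h.isCoveringMap.liftPath_const (e := z) rfl
    have h3 := (DFunLike.congr_fun h1 1).trans (key.trans (DFunLike.congr_fun h2 1))
    apply hγ
    rw [← hcL]
    simpa [lift] using h3

/-- A nontrivial geodesic loop lifts to a path of speed at most `1` that joins `z` to a different
point of its orbit. -/
theorem exists_lift (h : IsFuchsianQuotientMap Γ π) {z : ℍ} {L : ℝ} {σ : ℝ → X}
    (hσ : IsNontrivialGeodesicLoop (π z) L σ) :
    ∃ (c : ℝ → ℍ) (γ : Γ), c 0 = z ∧ c L = γ • z ∧ γ • z ≠ z ∧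
      (∀ t ∈ Set.Icc 0 L, π (c t) = σ t) ∧
      ∀ t ∈ Set.Icc 0 L, ∀ u ∈ Set.Icc 0 L, t ≤ u → dist (c t) (c u) ≤ u - t := by
  obtain ⟨p, hp, hpn⟩ := hσ.nontrivial
  have hL := hσ.length_pos
  let cov := h.isCoveringMap
  let l := cov.liftPath p z p.source
  have hl0 : l 0 = z := cov.liftPath_zero _ _ _
  have hl (t : unitInterval) : π (l t) = p t := congrFun (cov.liftPath_lifts p z p.source) t
  obtain ⟨γ, hγ⟩ := (h.apply_eq_iff z (l 1)).mp (by rw [hl, p.target])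
  let c : ℝ → ℍ := fun t => l (Set.projIcc 0 1 zero_le_one (t / L))
  have hc : Continuous c := l.continuous.comp (continuous_projIcc.comp (by fun_prop))
  have hπc : ∀ t ∈ Set.Icc 0 L, π (c t) = σ t := by
    intro t ht
    have : t / L ∈ Set.Icc (0 : ℝ) 1 := ⟨div_nonneg ht.1 hL.le, (div_le_one hL).mpr ht.2⟩
    simp only [c]
    rw [hl, hp, Set.projIcc_of_mem zero_le_one this]
    congr 1
    change L * (t / L) = t
    field_simp
  refine ⟨c, γ, ?_, ?_, ?_, hπc, fun t ht u hu htu => ?_⟩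
  · simpa [c] using hl0
  · simp [c, hL.ne', hγ]
  · intro hne
    -- a closed lift is contractible in the simply connected `ℍ`, hence so is its image
    have hl1 : l 1 = z := hγ.symm.trans hne
    let P : Path z z := ⟨l, hl0, hl1⟩
    obtain ⟨F⟩ := SimplyConnectedSpace.paths_homotopic P (Path.refl z)
    have hp' : p = P.map h.continuous := by
      ext t
      exact (hl t).symm
    apply hpn
    rw [hp']
    exact ⟨F.map ⟨π, h.continuous⟩⟩
  · refine dist_le_sub_of_locally htu hc.continuousOn fun s hs => ?_
    have hsub : Set.Icc t u ⊆ Set.Icc 0 L := Set.Icc_subset_Icc ht.1 hu.2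
    obtain ⟨r, hr, hiso⟩ := h.exists_ball_dist_apply_eq (c s)
    obtain ⟨ε₁, hε₁, hgeo⟩ := hσ.geodesic s (hsub hs)
    obtain ⟨ε₂, hε₂, hcont⟩ := Metric.continuousAt_iff.mp hc.continuousAt r hr
    refine ⟨min ε₁ ε₂, lt_min hε₁ hε₂, fun v hv hvs => ?_⟩
    rw [← hiso _ (Metric.mem_ball_self hr) _ (hcont (hvs.trans_le (min_le_right _ _))),
      hπc s (hsub hs), hπc v (hsub hv), hgeo s (hsub hs) v (hsub hv) (by simpa)
        (hvs.trans_le (min_le_left _ _)), abs_sub_comm]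

theorem injRadius_le (h : IsFuchsianQuotientMap Γ π) {z : ℍ} {γ : Γ} (hγ : γ • z ≠ z) :
    injRadius (π z) ≤ dist z (γ • z) / 2 := by
  refine div_le_div_of_nonneg_right (csInf_le ⟨0, ?_⟩ (h.isNontrivialGeodesicLoop hγ)) zero_le_two
  rintro L ⟨σ, hσ⟩
  exact hσ.length_pos.le

theorem le_injRadius (h : IsFuchsianQuotientMap Γ π) {z : ℍ} {r : ℝ} (hne : ∃ γ : Γ, γ • z ≠ z)
    (hr : ∀ γ : Γ, γ • z ≠ z → 2 * r ≤ dist z (γ • z)) : r ≤ injRadius (π z) := by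
  rw [injRadius, le_div_iff₀ zero_lt_two, mul_comm]
  obtain ⟨γ, hγ⟩ := hne
  refine le_csInf ⟨_, h.isNontrivialGeodesicLoop hγ⟩ ?_
  rintro L ⟨σ, hσ⟩
  obtain ⟨c, η, hc0, hcL, hη, -, hlip⟩ := h.exists_lift hσ
  have := hlip 0 ⟨le_rfl, hσ.length_pos.le⟩ L ⟨hσ.length_pos.le, le_rfl⟩ hσ.length_pos.le
  rw [hc0, hcL, sub_zero] at this
  exact (hr η hη).trans this

end IsFuchsianQuotientMap

/-! ### The injectivity radius along a shortest loop -/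

theorem mainTheorem9 {X : Type*} [MetricSpace X] (hX : IsClosedHyperbolicSurface X)
    (p : X) (hp : injRadius p ≤ Real.arsinh 1)
    (σ : ℝ → X) (hσ : IsShortestGeodesicLoop p (2 * injRadius p) σ)
    (s : ℝ) (hs : s ∈ Set.Icc 0 (2 * injRadius p)) :
    (√2 - 1) * injRadius p ≤ injRadius (σ s) ∧ injRadius (σ s) ≤ injRadius p := by
  obtain ⟨hcomp, Γ, π, hpd, hfree, hsurj, hfib, hdist⟩ := hX
  have h : IsFuchsianQuotientMap Γ π := ⟨hpd, hfree, hsurj, hfib, hdist⟩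
  have hiso (η : Γ) (u v : ℍ) : dist (η • u) (η • v) = dist u v := dist_smul (η : SL(2, ℝ)) u v
  obtain ⟨z, rfl⟩ := hsurj p
  obtain ⟨c, γ, hc0, hcL, hγ, hπc, hlip⟩ := h.exists_lift hσ.1
  have hmin {η : Γ} (hη : η • z ≠ z) : 2 * injRadius (π z) ≤ dist z (η • z) := by
    linarith [h.injRadius_le hη]
  set L := 2 * injRadius (π z) with hL
  have hL0 : 0 < L := hσ.1.length_pos
  have h0 : (0 : ℝ) ∈ Set.Icc 0 L := ⟨le_rfl, hL0.le⟩
  have h1 : L ∈ Set.Icc 0 L := ⟨hL0.le, le_rfl⟩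
  have hγL : dist z (γ • z) = L := by
    refine le_antisymm ?_ (hmin hγ)
    simpa [hc0, hcL] using hlip 0 h0 L h1 hL0.le
  set w := c s with hw
  have hzw : dist z w ≤ s := by simpa [hc0] using hlip 0 h0 s hs hs.1
  have hwγ : dist w (γ • z) ≤ L - s := by simpa [hcL] using hlip s hs L h1 hs.2
  have hne (η : Γ) (hη : η • w ≠ w) (v : ℍ) : η • v ≠ v := fun hv => hη (hfree η v hv w)
  have hγw : γ • w ≠ w := fun hv => hγ (hfree γ w hv z)
  have hupper : dist w (γ • w) ≤ L := by
    have := dist_triangle w (γ • z) (γ • w)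
    rw [hiso] at this
    linarith
  rw [← hπc s hs, ← hw]
  refine ⟨h.le_injRadius ⟨γ, hγw⟩ fun η hη => ?_, (h.injRadius_le hγw).trans (by linarith)⟩
  -- `η` would displace `w` by less than `(√2 - 1) * L`
  by_contra! hlt
  have hs2 : 1 ≤ √2 := Real.one_le_sqrt.mpr (by norm_num)
  have hcomm : (γ : SL(2, ℝ)) * η = η * γ := by
    refine commute_of_dist_smul_lt h.eq_one_or_neg_one_or_four_lt_trace_sq γ.2 η.2 w
      (hupper.trans (by linarith)) (sinh_lt_of_lt_mul_arsinh_one ?_)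
    have := mul_le_mul_of_nonneg_left hp (sub_nonneg.mpr hs2)
    change dist w (η • w) / 2 < _
    linarith
  have hle : dist w (γ • w) ≤ dist w (η • w) :=
    dist_smul_le_dist_smul_of_commute hcomm hγ (hγL.trans_le (hmin (hne η hη z))) w
  have hpath : dist z (γ • γ • z) ≤ L + dist w (γ • w) := by
    have t1 := dist_triangle4 z w (γ • w) (γ • γ • z)
    rw [hiso] at t1
    linarith
  have htr : 2 ≤ |(γ : SL(2, ℝ)).val.trace| := by
    have h4 : 2 ^ 2 ≤ (γ : SL(2, ℝ)).val.trace ^ 2 := by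
      rcases h.eq_one_or_neg_one_or_four_lt_trace_sq γ γ.2 with h | h | h
      · rw [h]; norm_num
      · rw [h]; norm_num
      · linarith
    simpa using sq_le_sq.mp h4
  have hsq : √2 * L ≤ dist z (γ • γ • z) := by
    have e1 : Real.sinh (dist z (γ • γ • z) / 2) =
        |(γ : SL(2, ℝ)).val.trace| * Real.sinh (dist z (γ • z) / 2) :=
      sinh_half_dist_smul_smul γ z
    have e2 := sinh_sqrt_two_mul_le (x := L / 2) (by linarith) (by linarith)
    rw [hγL] at e1
    have e3 : Real.sinh (√2 * (L / 2)) ≤ Real.sinh (dist z (γ • γ • z) / 2) := by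
      rw [e1]
      exact e2.trans (mul_le_mul_of_nonneg_right htr (Real.sinh_nonneg_iff.mpr (by linarith)))
    rw [Real.sinh_le_sinh] at e3
    linarith
  linarith
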